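/- Let $\mathcal H$ be a complex Hilbert space with an orthonormal basis $(e_n)_{n=1}^\infty$, and let $\mathcal B(\mathcal H)$ be the algebra of bounded linear operators on $\mathcal H$. Let $\mathrm{nil}_2 := \{M \in \mathcal B(\mathcal H) : M^2 = 0\}$ and $\mathfrak c(\mathrm{nil}_2) := \{MN - NM : M, N \in \mathrm{nil}_2\}$, and let $\mathrm{clos}$ denote closure in the operator norm. Let $(w_n)_{n=1}^\infty \in \ell^\infty$ be a bounded sequence of complex numbers with $\inf_n |w_n| > 0$, and let $W \in \mathcal B(\mathcal H)$ be the unilateral forward weighted shift with weight sequence $(w_n)_n$, that is, the bounded operator with $W e_n = w_n e_{n+1}$ for all $n \ge 1$. Then $$W \notin \mathrm{clos}(\mathfrak c(\mathrm{nil}_2)).$$ -/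

import Mathlib

open scoped ENNReal

noncomputable section

/-- The set `nil₂` of square-zero bounded operators on `H`. -/
def nilTwo (H : Type*) [NormedAddCommGroup H] [InnerProductSpace ℂ H] : Set (H →L[ℂ] H) :=
  {M | M * M = 0}

/-- `𝔠(Ω) = {AB - BA : A, B ∈ Ω}`, the set of commutators of elements of `Ω`. -/
def commutators {H : Type*} [NormedAddCommGroup H] [InnerProductSpace ℂ H]
    (Ω : Set (H →L[ℂ] H)) : Set (H →L[ℂ] H) :=
  {T | ∃ A ∈ Ω, ∃ B ∈ Ω, T = A * B - B * A}

/-- For bounded `w` and square-summable `x`, `|wₙ xₙ| ≤ |‖w‖ xₙ|`. -/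
theorem norm_mul_le_smul (w : lp (fun _ : ℕ => ℂ) ∞) (x : lp (fun _ : ℕ => ℂ) 2) (n : ℕ) :
    ‖w n * x n‖ ≤ ‖((‖w‖ : ℂ) • x) n‖ := by
  simp only [norm_mul, lp.coeFn_smul, Pi.smul_apply, norm_smul, Complex.norm_real, norm_norm]
  exact mul_le_mul_of_nonneg_right (lp.norm_apply_le_norm ENNReal.top_ne_zero w n) (norm_nonneg _)

/-- The sequence `(wₙ xₙ)ₙ` is square-summable, for bounded `w` and square-summable `x`. -/
theorem memlp_two_mul (w : lp (fun _ : ℕ => ℂ) ∞) (x : lp (fun _ : ℕ => ℂ) 2) :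
    Memℓp (fun n => w n * x n) 2 :=
  (lp.memℓp ((‖w‖ : ℂ) • x)).mono' (norm_mul_le_smul w x)

/-- The diagonal operator `(xₙ)ₙ ↦ (wₙ xₙ)ₙ` on `ℓ²`, for a bounded sequence `w`. -/
def diagOp (w : lp (fun _ : ℕ => ℂ) ∞) :
    lp (fun _ : ℕ => ℂ) 2 →L[ℂ] lp (fun _ : ℕ => ℂ) 2 :=
  LinearMap.mkContinuous
    { toFun := fun x => ⟨fun n => w n * x n, memlp_two_mul w x⟩
      map_add' := fun x y => lp.ext (funext fun n => mul_add (w n) (x n) (y n))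
      map_smul' := fun c x => lp.ext (funext fun n => mul_left_comm (w n) c (x n)) }
    ‖w‖ (fun x => by
      refine (lp.norm_mono two_ne_zero (y := (‖w‖ : ℂ) • x) (norm_mul_le_smul w x)).trans ?_
      rw [norm_smul, Complex.norm_real, norm_norm])

/-- The unilateral forward weighted shift with respect to the orthonormal basis `(eₙ)`, with bounded
weight sequence `(wₙ)`: the bounded operator `∑ₙ xₙ eₙ ↦ ∑ₙ wₙ xₙ eₙ₊₁`. -/
def weightedShift {H : Type*} [NormedAddCommGroup H] [InnerProductSpace ℂ H] [CompleteSpace H]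
    (e : HilbertBasis ℕ ℂ H) (w : lp (fun _ : ℕ => ℂ) ∞) : H →L[ℂ] H :=
  (e.orthonormal.comp Nat.succ Nat.succ_injective).orthogonalFamily.linearIsometry.toContinuousLinearMap
    ∘L diagOp w ∘L (e.repr : H →L[ℂ] lp (fun _ : ℕ => ℂ) 2)

/-- The weighted shift is the bounded operator with `W eₙ = wₙ eₙ₊₁` for all `n`. -/
theorem weightedShift_basis {H : Type*} [NormedAddCommGroup H] [InnerProductSpace ℂ H]
    [CompleteSpace H] (e : HilbertBasis ℕ ℂ H) (w : lp (fun _ : ℕ => ℂ) ∞) (n : ℕ) :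
    weightedShift e w (e n) = w n • e (n + 1) := by
  have h : diagOp w (e.repr (e n)) = lp.single 2 n (w n) := by
    rw [e.repr_self]
    refine lp.ext (funext fun m => ?_)
    change w m * (lp.single 2 n (1 : ℂ) : lp (fun _ : ℕ => ℂ) 2) m = _
    rcases eq_or_ne m n with rfl | hm
    · simp
    · simp [hm]
  change (e.orthonormal.comp Nat.succ Nat.succ_injective).orthogonalFamily.linearIsometry
    (diagOp w (e.repr (e n))) = _
  rw [h, OrthogonalFamily.linearIsometry_apply_single]
  rfl

end

/-! The obstruction is a parity of codimensions. If `T = MN - NM` with `M² = N² = 0` and `S = M +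
N`, then `T² = S⁴`. For injective maps the codimension of the range is additive under composition,
so an injective `T` with range of codimension one would give `2 = 4 · codim S`, which is impossible.
This is pure linear algebra; topology only transfers it to the closure: with `L` a bounded left
inverse of `W`, every `T` near `W` has `L T` invertible, so `T` is injective and its range has
codimension `dim ker L = 1`. -/

/-- Codimensions of ranges add under composition with an injective map on the left. -/
theorem rank_quotient_range_comp {K V : Type*} [Field K] [AddCommGroup V] [Module K V]
    (A B : V →ₗ[K] V) (hA : Function.Injective A) :
    Module.rank K (V ⧸ (A ∘ₗ B).range) =
      Module.rank K (V ⧸ A.range) + Module.rank K (V ⧸ B.range) := by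
  have hle : (A ∘ₗ B).range ≤ A.range := LinearMap.range_comp_le_range B A
  -- `A` induces an isomorphism from `V / ran B` onto `ran A / ran AB`.
  have hker : ((A ∘ₗ B).range.mkQ ∘ₗ A).ker = B.range := by
    ext x
    simp [hA.eq_iff]
  have hrange : ((A ∘ₗ B).range.mkQ ∘ₗ A).range = A.range.map (A ∘ₗ B).range.mkQ :=
    LinearMap.range_comp _ _
  rw [← Submodule.rank_quotient_add_rank (A.range.map (A ∘ₗ B).range.mkQ),
    (Submodule.quotientQuotientEquivQuotient _ _ hle).rank_eq, ← hrange,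
    ← ((A ∘ₗ B).range.mkQ ∘ₗ A).quotKerEquivRange.rank_eq, hker]

/-- If `L ∘ T` is bijective, then `ker L` is a complement of the range of `T`. -/
theorem rank_quotient_range_eq_rank_ker {K V : Type*} [Field K] [AddCommGroup V] [Module K V]
    (L T : V →ₗ[K] V) (h : Function.Bijective (L ∘ₗ T)) :
    Module.rank K (V ⧸ T.range) = Module.rank K L.ker := by
  refine (Submodule.quotientEquivOfIsCompl T.range L.ker ⟨?_, ?_⟩).rank_eq
  · rw [Submodule.disjoint_def]
    rintro _ ⟨x, rfl⟩ hx
    have : x = 0 := h.1 (by simpa using hx)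
    simp [this]
  · rw [codisjoint_iff, Submodule.eq_top_iff']
    intro y
    obtain ⟨x, hx⟩ := h.2 (L y)
    exact Submodule.mem_sup.2 ⟨T x, ⟨x, rfl⟩, y - T x, by simpa [sub_eq_zero] using hx.symm,
      by simp⟩

/-- The square of a commutator of square-zero elements is the fourth power of their sum. -/
theorem commutator_sq_eq_add_pow_four {R : Type*} [Ring R] {M N : R} (hM : M * M = 0)
    (hN : N * N = 0) :
    (M * N - N * M) * (M * N - N * M) = (M + N) * (M + N) * ((M + N) * (M + N)) := by
  have h : (M + N) * (M + N) = M * N + N * M := by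
    rw [add_mul, mul_add, mul_add, hM, hN, zero_add, add_zero]
  have h₁ : M * N * (N * M) = 0 := by rw [mul_assoc, ← mul_assoc N, hN, zero_mul, mul_zero]
  have h₂ : N * M * (M * N) = 0 := by rw [mul_assoc, ← mul_assoc M, hM, zero_mul, mul_zero]
  rw [h]
  simp only [sub_mul, mul_sub, add_mul, mul_add, h₁, h₂]
  abel

/-- A commutator of two square-zero linear maps that is injective does not have a range of
codimension one. -/
theorem rank_quotient_range_commutator_ne_one {K V : Type*} [Field K] [AddCommGroup V]
    [Module K V] {M N : Module.End K V} (hM : M * M = 0) (hN : N * N = 0)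
    (hinj : Function.Injective (M * N - N * M)) :
    Module.rank K (V ⧸ (M * N - N * M).range) ≠ 1 := by
  intro hT
  have hsq := commutator_sq_eq_add_pow_four hM hN
  set T := M * N - N * M
  set S := M + N
  have hS : Function.Injective S := by
    have : Function.Injective (S * S * (S * S)) := hsq ▸ hinj.comp hinj
    exact Function.Injective.of_comp (f := S * S * S) (by rwa [← mul_assoc] at this)
  have h := rank_quotient_range_comp T T hinj
  have h₂ := rank_quotient_range_comp S S hS
  have h₄ := rank_quotient_range_comp (S * S) (S * S) (hS.comp hS)
  simp only [← Module.End.mul_eq_comp] at h h₂ h₄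
  have hcongr : Module.rank K (V ⧸ (T * T).range) = Module.rank K (V ⧸ (S * S * (S * S)).range) :=
    congrArg (fun A : Module.End K V => Module.rank K (V ⧸ A.range)) hsq
  rw [hcongr, h₄, h₂, hT] at h
  -- `h` is an equation of cardinals; finiteness must come before the parity argument in `ℕ`.
  have hlt : Module.rank K (V ⧸ S.range) < Cardinal.aleph0 := by
    refine lt_of_le_of_lt ?_ (Cardinal.natCast_lt_aleph0 (n := 2))
    calc Module.rank K (V ⧸ S.range) ≤ _ := le_self_add.trans le_self_add
      _ = 2 := by rw [h]; norm_num
  obtain ⟨n, hn⟩ := Cardinal.lt_aleph0.1 hlt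
  rw [hn] at h
  norm_cast at h
  omega

/-- A weighted shift with weights bounded away from zero has a bounded left inverse with
one-dimensional kernel. -/
theorem exists_leftInverse_weightedShift {H : Type*} [NormedAddCommGroup H]
    [InnerProductSpace ℂ H] [CompleteSpace H] (e : HilbertBasis ℕ ℂ H)
    (w : lp (fun _ : ℕ => ℂ) ∞) (hw : 0 < ⨅ n, ‖w n‖) :
    ∃ L : H →L[ℂ] H, L * weightedShift e w = 1 ∧
      Module.rank ℂ (L : H →ₗ[ℂ] H).ker = 1 := by
  have hle (n : ℕ) : ⨅ n, ‖w n‖ ≤ ‖w n‖ := ciInf_le ⟨0, by rintro _ ⟨n, rfl⟩; positivity⟩ n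
  have hne (n : ℕ) : w n ≠ 0 := norm_pos_iff.1 (hw.trans_le (hle n))
  let v : lp (fun _ : ℕ => ℂ) ∞ := ⟨fun n => (w n)⁻¹, memℓp_infty ⟨(⨅ n, ‖w n‖)⁻¹, by
    rintro _ ⟨n, rfl⟩
    simpa using inv_anti₀ hw (hle n)⟩⟩
  have hvw (x) : diagOp v (diagOp w x) = x := lp.ext (funext fun n => inv_mul_cancel_left₀ (hne n) _)
  have hwv (x) : diagOp w (diagOp v x) = x := lp.ext (funext fun n => mul_inv_cancel_left₀ (hne n) _)
  let U := (e.orthonormal.comp Nat.succ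
    Nat.succ_injective).orthogonalFamily.linearIsometry.toContinuousLinearMap
  have hU (n : ℕ) : U (lp.single 2 n 1) = e (n + 1) := by
    change (e.orthonormal.comp Nat.succ Nat.succ_injective).orthogonalFamily.linearIsometry _ = _
    rw [OrthogonalFamily.linearIsometry_apply_single]
    simp
  have hUU (x) : U.adjoint (U x) = x :=
    ext_inner_right ℂ fun y => by
      rw [ContinuousLinearMap.adjoint_inner_left]
      exact LinearIsometry.inner_map_map _ _ _
  have hUcoord (x : H) (n : ℕ) : U.adjoint x n = e.repr x (n + 1) := by
    rw [e.repr_apply_apply, ← hU, ← ContinuousLinearMap.adjoint_inner_right,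
      lp.inner_single_left]
    simp
  -- In coordinates, `L` is the backward shift followed by division by the weights, so its kernel is
  -- spanned by `e 0`.
  refine ⟨(e.repr.symm : lp (fun _ : ℕ => ℂ) 2 →L[ℂ] H) ∘L diagOp v ∘L U.adjoint, ?_, ?_⟩
  · ext x
    change e.repr.symm (diagOp v (U.adjoint (U (diagOp w (e.repr x))))) = x
    rw [hUU, hvw, e.repr.symm_apply_apply]
  · have hker : ((e.repr.symm : lp (fun _ : ℕ => ℂ) 2 →L[ℂ] H) ∘L diagOp v ∘L U.adjoint :
        H →ₗ[ℂ] H).ker = ℂ ∙ e 0 := by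
      ext x
      rw [LinearMap.mem_ker, Submodule.mem_span_singleton]
      change e.repr.symm (diagOp v (U.adjoint x)) = 0 ↔ _
      rw [map_eq_zero_iff _ e.repr.symm.injective,
        map_eq_zero_iff _ (Function.LeftInverse.injective hwv)]
      constructor
      · intro h
        refine ⟨e.repr x 0, e.repr.injective (lp.ext (funext fun n => ?_))⟩
        rw [map_smul, e.repr_self]
        cases n with
        | zero => simp
        | succ n => simp [← hUcoord, h]
      · rintro ⟨a, rfl⟩
        refine lp.ext (funext fun n => ?_)
        rw [hUcoord, map_smul, e.repr_self]
        simp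
    rw [hker]
    exact (rank_submodule_eq_one_iff _).2 ⟨e 0, Submodule.mem_span_singleton_self _,
      e.orthonormal.ne_zero 0, le_rfl⟩

theorem proposition4p20 {H : Type*} [NormedAddCommGroup H] [InnerProductSpace ℂ H]
    [CompleteSpace H] (e : HilbertBasis ℕ ℂ H) (w : lp (fun _ : ℕ => ℂ) ∞)
    (hw : 0 < ⨅ n, ‖w n‖) :
    weightedShift e w ∉ closure (commutators (nilTwo H)) := by
  obtain ⟨L, hLW, hL⟩ := exists_leftInverse_weightedShift e w hw
  intro hmem
  have hopen : IsOpen {T : H →L[ℂ] H | IsUnit (L * T)} :=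
    Units.isOpen.preimage (continuous_const.mul continuous_id)
  obtain ⟨_, hT, M, hM, N, hN, rfl⟩ :=
    mem_closure_iff.1 hmem _ hopen (by simp [hLW])
  have hbij : Function.Bijective (L * (M * N - N * M)) := by
    obtain ⟨u, hu⟩ := hT
    rw [← hu]
    exact (ContinuousLinearEquiv.unitsEquiv ℂ H u).bijective
  refine rank_quotient_range_commutator_ne_one (M := (M : H →ₗ[ℂ] H)) (N := (N : H →ₗ[ℂ] H))
    (congrArg ContinuousLinearMap.toLinearMap hM) (congrArg ContinuousLinearMap.toLinearMap hN)
    (Function.Injective.of_comp hbij.1) ?_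
  rw [← hL]
  exact rank_quotient_range_eq_rank_ker (L : H →ₗ[ℂ] H) _ hbij
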